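/- **Theorem (Seifert–van Kampen, groupoid version in $\mathrm{Lim}$).** *Conventions.* A *limit space* is a set $X$ with a relation $\mathcal F\to x$ between proper filters $\mathcal F$ on $X$ (equivalently, nets up to tail equivalence) and points $x\in X$ such that: the principal filter of $x$ converges to $x$; if $\mathcal F\to x$ and $\mathcal F\subseteq\mathcal G$ then $\mathcal G\to x$; if $\mathcal F\to x$ and $\mathcal G\to x$ then $\mathcal F\cap\mathcal G\to x$. A map is *continuous* if it sends filters converging to $x$ to filters (generated by the images) converging to the image of $x$; $\mathrm{Lim}$ is the category of limit spaces and continuous maps. A subset $U\subseteq X$ carries the subspace convergence: a filter on $U$ converges to $x\in U$ iff the filter it generates on $X$ converges to $x$. The set $C(X,Y)$ of continuous maps carries continuous convergence: $\mathcal F\to f$ iff for all $\mathcal G\to x$ in $X$ the filter generated by the sets $\{g(z):g\in F,\ z\in G\}$, with $F\in\mathcal F$ and $G\in\mathcal G$, converges to $f(x)$ in $Y$. A *convergence system* for $X$ is a family $\mathcal O$ of subsets of $X$ such that every filter converging to some point of $X$ has some $U\in\mathcal O$ as a member. Let $I=[0,1]$ with its usual topological convergence. Paths in $X$ are continuous maps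 $I\to X$. Two paths $\gamma,\gamma'$ from $x$ to $y$ are *rel-homotopic* if there is a path $H:I\to C(I,X)$ from $\gamma$ to $\gamma'$ such that each $H(t)$ is a path from $x$ to $y$. The *fundamental groupoid* $\Pi(X)$ has the points of $X$ as objects and rel-homotopy classes of paths from $x$ to $y$ as arrows $x\to y$, with composition induced by concatenation of paths; $f\mapsto([\gamma]\mapsto[f\circ\gamma])$ makes $\Pi$ a functor $\mathrm{Lim}\to\mathrm{Groupoid}$. *Statement.* Let $X$ be a limit space and let $\mathcal O$ be a convergence system for $X$ such that $U\cap V\in\mathcal O$ for all $U,V\in\mathcal O$. Regard $\mathcal O$ as a small category whose morphisms are the inclusions, and let $\Pi|_{\mathcal O}:\mathcal O\to\mathrm{Groupoid}$ be the diagram sending $U$ to $\Pi(U)$, where $U$ has the subspace convergence, and an inclusion to the functor it induces. Then $$\Pi(X)=\operatorname{colim}\,\Pi|_{\mathcal O};$$ more precisely, the cocone formed by the functors $\Pi(U)\to\Pi(X)$ induced by the inclusions $U\subseteq X$, $U\in\mathcal O$, is a colimit cocone of $\Pi|_{\mathcal O}$ in the category of (small) groupoids. -/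

import Mathlib

open CategoryTheory Filter Topology

universe u v w

/-- A limit space: a set with a convergence that is centered, isotone and stable. Convergence is
recorded on filters, i.e. on nets up to tail equivalence: a net `φ` corresponds to the filter of all
sets containing a tail set of `φ`. A constant net corresponds to `pure x`, a subnet to a smaller
filter (in Mathlib's order, `F ≤ G` means that `F` has more members), and stability under mixings of
nets to stability under binary suprema (the filter `F ⊔ G` consists of the common members of `F` and
`G`). Isotonicity forces the improper filter `⊥` to converge to every point, so allowing it adds
no data. -/
class LimitSpace (X : Type u) where
  /-- `Converges F x`: the filter `F` converges to the point `x`. -/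
  Converges : Filter X → X → Prop
  centered : ∀ x, Converges (pure x) x
  isotone : ∀ {F G : Filter X} {x : X}, F ≤ G → Converges G x → Converges F x
  stable : ∀ {F G : Filter X} {x : X}, Converges F x → Converges G x → Converges (F ⊔ G) x

namespace LimitSpace

/-- The standard convergence of a topological space. -/
@[reducible] def ofTopology (Z : Type u) [TopologicalSpace Z] : LimitSpace Z where
  Converges F z := F ≤ 𝓝 z
  centered z := pure_le_nhds z
  isotone h h' := h.trans h'
  stable := sup_le

/-- The subspace convergence: a filter on `s` converges iff its image in `X` does. -/
instance subspace {X : Type u} [LimitSpace X] (s : Set X) : LimitSpace s where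
  Converges F x := Converges (map Subtype.val F) x.1
  centered x := by simpa using centered x.1
  isotone h h' := isotone (map_mono h) h'
  stable h h' := by simpa [Filter.map_sup] using stable h h'

/-- The unit interval, with its standard topological convergence. -/
instance onUnitInterval : LimitSpace unitInterval := ofTopology _

/-- `𝒞` is a convergence system: whenever a filter `F` converges to some point, some member of `𝒞`
belongs to `F` (that is, whenever a net converges, some member of `𝒞` contains one of its
tail sets). -/
def IsConvergenceSystem {X : Type u} [LimitSpace X] (𝒞 : Set (Set X)) : Prop :=
  ∀ (x : X) (F : Filter X), Converges F x → ∃ C ∈ 𝒞, C ∈ F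

end LimitSpace

open LimitSpace

/-- Continuous maps between limit spaces. -/
structure LimMap (X : Type u) (Y : Type v) [LimitSpace X] [LimitSpace Y] where
  toFun : X → Y
  conv_map : ∀ {F : Filter X} {x : X}, Converges F x → Converges (map toFun F) (toFun x)

namespace LimMap

variable {X : Type u} {Y : Type v} {Z : Type w} [LimitSpace X] [LimitSpace Y] [LimitSpace Z]

instance : FunLike (LimMap X Y) X Y where
  coe := toFun
  coe_injective f g h := by cases f; cases g; congr

@[ext] theorem ext {f g : LimMap X Y} (h : ∀ x, f x = g x) : f = g := DFunLike.ext _ _ h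

@[simp] theorem coe_mk (f : X → Y) (h) (x : X) : (LimMap.mk f h : LimMap X Y) x = f x := rfl

/-- The identity map. -/
def id (X : Type u) [LimitSpace X] : LimMap X X where
  toFun x := x
  conv_map h := by simpa using h

/-- Composition of continuous maps. -/
def comp (g : LimMap Y Z) (f : LimMap X Y) : LimMap X Z where
  toFun x := g (f x)
  conv_map h := by
    have h' := g.conv_map (f.conv_map h)
    rw [Filter.map_map] at h'
    exact h'

@[simp] theorem id_apply (x : X) : LimMap.id X x = x := rfl

@[simp] theorem comp_apply (g : LimMap Y Z) (f : LimMap X Y) (x : X) : g.comp f x = g (f x) := rfl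

/-- Continuous convergence on the set of continuous maps: `𝓕` converges to `f` iff the image of
`𝓕 ×ˢ G` under evaluation converges to `f x` whenever `G` converges to `x`. -/
instance continuousConvergence : LimitSpace (LimMap X Y) where
  Converges 𝓕 f := ∀ (G : Filter X) (x : X), Converges G x →
    Converges (map (fun p : LimMap X Y × X => p.1 p.2) (𝓕 ×ˢ G)) (f x)
  centered f G x h := by
    rw [pure_prod, Filter.map_map]
    exact f.conv_map h
  isotone h h' G x hG := isotone (map_mono (prod_mono h le_rfl)) (h' G x hG)
  stable h h' G x hG := by
    rw [sup_prod, Filter.map_sup]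
    exact stable (h G x hG) (h' G x hG)

end LimMap

/-- The inclusion of a subspace. -/
def LimMap.subtypeVal {X : Type u} [LimitSpace X] (s : Set X) : LimMap s X where
  toFun := Subtype.val
  conv_map h := h

/-- The inclusion of a subspace into a larger one. -/
def LimMap.inclusion {X : Type u} [LimitSpace X] {s t : Set X} (h : s ⊆ t) : LimMap s t where
  toFun := Set.inclusion h
  conv_map h := by
    change Converges (map Subtype.val (map _ _)) _
    rw [Filter.map_map]
    exact h

/-! ### Maps from topological spaces into limit spaces -/

/-- Continuity of a map from a topological space (with its standard convergence) to a
limit space. -/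
def TCont {Z : Type w} {X : Type u} [TopologicalSpace Z] [LimitSpace X] (f : Z → X) : Prop :=
  ∀ z, Converges (map f (𝓝 z)) (f z)

namespace TCont

variable {Z W : Type*} {X : Type u} [TopologicalSpace Z] [TopologicalSpace W] [LimitSpace X]

theorem comp {f : Z → X} (hf : TCont f) {g : W → Z} (hg : Continuous g) :
    TCont (fun a => f (g a)) := fun a =>
  isotone (by
    have : map (fun a => f (g a)) (𝓝 a) = map f (map g (𝓝 a)) := by rw [Filter.map_map]; rfl
    rw [this]
    exact map_mono (hg.tendsto a)) (hf (g a))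

theorem const (x : X) : TCont (fun _ : Z => x) := fun _ =>
  isotone (tendsto_const_pure : Tendsto _ _ _) (centered x)

theorem map {Y : Type v} [LimitSpace Y] {f : Z → X} (hf : TCont f) (g : LimMap X Y) :
    TCont (fun z => g (f z)) := fun z => by
  have h := g.conv_map (hf z)
  rw [Filter.map_map] at h
  exact h

/-- Pasting along `{a ≤ b}` and `{b ≤ a}`. -/
theorem if_le {f g : Z → X} (hf : TCont f) (hg : TCont g) {a b : Z → ℝ} (ha : Continuous a)
    (hb : Continuous b) (h : ∀ z, a z = b z → f z = g z) :
    TCont (fun z => if a z ≤ b z then f z else g z) := by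
  intro z
  rcases lt_trichotomy (a z) (b z) with hz | hz | hz
  · have e : (fun z => if a z ≤ b z then f z else g z) =ᶠ[𝓝 z] f := by
      filter_upwards [ha.continuousAt.eventually_lt hb.continuousAt hz] with y hy
      simp [hy.le]
    rw [map_congr e]
    simpa [hz.le] using hf z
  · have key : Converges (Filter.map f (𝓝 z) ⊔ Filter.map g (𝓝 z)) (f z) :=
      stable (hf z) (by rw [h z hz]; exact hg z)
    simp only [hz.le, if_true]
    refine isotone ?_ key
    intro s hs
    simp only [mem_sup, mem_map] at hs ⊢
    filter_upwards [hs.1, hs.2] with y h1 h2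
    simp only [Set.mem_preimage] at h1 h2 ⊢
    split_ifs <;> assumption
  · have e : (fun z => if a z ≤ b z then f z else g z) =ᶠ[𝓝 z] g := by
      filter_upwards [hb.continuousAt.eventually_lt ha.continuousAt hz] with y hy
      simp [hy.not_ge]
    rw [map_congr e]
    simpa [hz.not_ge] using hg z

/-- A map out of the unit interval, as a morphism of limit spaces. -/
def toLimMap {f : unitInterval → X} (hf : TCont f) : LimMap unitInterval X where
  toFun := f
  conv_map h := isotone (map_mono h) (hf _)

end TCont

theorem LimMap.tCont {X : Type u} [LimitSpace X] (f : LimMap unitInterval X) : TCont f :=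
  fun z => f.conv_map (le_refl (𝓝 z))

/-! ### Paths and homotopies -/

/-- Paths from `x` to `y`: continuous maps from the unit interval with the given end points. -/
@[ext] structure LimPath {X : Type u} [LimitSpace X] (x y : X) extends LimMap unitInterval X where
  source : toFun 0 = x
  target : toFun 1 = y

namespace LimPath

variable {X : Type u} [LimitSpace X] {x y z : X}

instance : CoeFun (LimPath x y) (fun _ => unitInterval → X) where
  coe γ := γ.toFun

theorem tCont (γ : LimPath x y) : TCont (γ : unitInterval → X) := γ.toLimMap.tCont

/-- A path from a function that is continuous in the sense of `TCont`. -/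
def ofTCont (f : unitInterval → X) (hf : TCont f) (h0 : f 0 = x) (h1 : f 1 = y) : LimPath x y where
  toLimMap := hf.toLimMap
  source := h0
  target := h1

/-- Two paths from `x` to `y` are homotopic relative to their end points if there is a path
`H` from one to the other in the space of continuous maps from the unit interval to `X`, with
continuous convergence, such that each `H t` is a path from `x` to `y`. -/
def Homotopic (γ γ' : LimPath x y) : Prop :=
  ∃ H : LimMap unitInterval (LimMap unitInterval X),
    H 0 = γ.toLimMap ∧ H 1 = γ'.toLimMap ∧ ∀ t, H t 0 = x ∧ H t 1 = y

/-- Rel-homotopies in uncurried form. -/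
theorem homotopic_iff {γ γ' : LimPath x y} : Homotopic γ γ' ↔
    ∃ K : unitInterval × unitInterval → X, TCont K ∧ (∀ s, K (0, s) = γ s) ∧
      (∀ s, K (1, s) = γ' s) ∧ ∀ t, K (t, 0) = x ∧ K (t, 1) = y := by
  constructor
  · rintro ⟨H, h0, h1, h⟩
    refine ⟨fun p => H p.1 p.2, ?_, fun s => ?_, fun s => ?_, h⟩
    · rintro ⟨t, s⟩
      have := H.tCont t (𝓝 s) s (le_refl (𝓝 s))
      rw [prod_map_left, Filter.map_map, ← nhds_prod_eq] at this
      exact this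
    · simp only [h0]; rfl
    · simp only [h1]; rfl
  · rintro ⟨K, hK, h0, h1, h⟩
    have hs : ∀ t, TCont (fun s => K (t, s)) := fun t => hK.comp (by fun_prop)
    have hH : TCont (fun t => (hs t).toLimMap) := by
      intro t G s hG
      rw [prod_map_left, Filter.map_map]
      refine isotone (map_mono (prod_mono le_rfl hG)) ?_
      rw [← nhds_prod_eq]
      exact hK (t, s)
    exact ⟨hH.toLimMap, LimMap.ext h0, LimMap.ext h1, h⟩

theorem Homotopic.refl (γ : LimPath x y) : Homotopic γ γ :=
  homotopic_iff.2 ⟨fun p => γ p.2, γ.tCont.comp continuous_snd, fun _ => rfl, fun _ => rfl,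
    fun _ => ⟨γ.source, γ.target⟩⟩

theorem Homotopic.symm {γ γ' : LimPath x y} (h : Homotopic γ γ') : Homotopic γ' γ := by
  obtain ⟨K, hK, h0, h1, h⟩ := homotopic_iff.1 h
  exact homotopic_iff.2 ⟨fun p => K (unitInterval.symm p.1, p.2), hK.comp (by fun_prop),
    fun s => by simpa using h1 s, fun s => by simpa using h0 s, fun t => h _⟩

/-- The reparametrization `t ↦ 2 t`, meant for `t ≤ 1 / 2`. -/
noncomputable def dbl (t : unitInterval) : unitInterval :=
  Set.projIcc (0 : ℝ) 1 zero_le_one (2 * t)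

/-- The reparametrization `t ↦ 2 t - 1`, meant for `1 / 2 ≤ t`. -/
noncomputable def dbl' (t : unitInterval) : unitInterval :=
  Set.projIcc (0 : ℝ) 1 zero_le_one (2 * t - 1)

@[fun_prop] theorem continuous_dbl : Continuous dbl := by unfold dbl; fun_prop

@[fun_prop] theorem continuous_dbl' : Continuous dbl' := by unfold dbl'; fun_prop

@[simp] theorem dbl_zero : dbl 0 = 0 := by
  simp [dbl]

@[simp] theorem dbl'_one : dbl' 1 = 1 := by
  norm_num [dbl']

theorem dbl_of_half {t : unitInterval} (h : (t : ℝ) = 1 / 2) : dbl t = 1 := by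
  norm_num [dbl, h]

theorem dbl'_of_half {t : unitInterval} (h : (t : ℝ) = 1 / 2) : dbl' t = 0 := by
  norm_num [dbl', h]

theorem coe_dbl {t : unitInterval} (h : (t : ℝ) ≤ 1 / 2) : (dbl t : ℝ) = 2 * t := by
  have := t.2.1
  rw [dbl, Set.projIcc_of_mem zero_le_one ⟨by linarith, by linarith⟩]

theorem coe_dbl' {t : unitInterval} (h : 1 / 2 ≤ (t : ℝ)) : (dbl' t : ℝ) = 2 * t - 1 := by
  have := t.2.2
  rw [dbl', Set.projIcc_of_mem zero_le_one ⟨by linarith, by linarith⟩]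

theorem Homotopic.trans {γ γ' γ'' : LimPath x y} (h : Homotopic γ γ') (h' : Homotopic γ' γ'') :
    Homotopic γ γ'' := by
  obtain ⟨K, hK, a0, a1, a⟩ := homotopic_iff.1 h
  obtain ⟨L, hL, b0, b1, b⟩ := homotopic_iff.1 h'
  refine homotopic_iff.2 ⟨fun p => if (p.1 : ℝ) ≤ 1 / 2 then K (dbl p.1, p.2) else L (dbl' p.1, p.2),
    TCont.if_le (hK.comp (by fun_prop)) (hL.comp (by fun_prop)) (by fun_prop) (by fun_prop) ?_,
    ?_, ?_, ?_⟩
  · intro p hp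
    rw [dbl_of_half hp, dbl'_of_half hp, a1, b0]
  · intro s
    simp [a0]
  · intro s
    norm_num [b1]
  · intro t
    dsimp only
    split_ifs
    · exact a _
    · exact b _

/-- The setoid of rel-homotopy on the paths from `x` to `y`. -/
def setoid (x y : X) : Setoid (LimPath x y) :=
  ⟨Homotopic, Homotopic.refl, Homotopic.symm, Homotopic.trans⟩

/-- The constant path. -/
def refl (x : X) : LimPath x x := ofTCont (fun _ => x) (TCont.const x) rfl rfl

/-- The reversed path. -/
def symm (γ : LimPath x y) : LimPath y x :=
  ofTCont (fun t => γ (unitInterval.symm t)) (γ.tCont.comp (by fun_prop))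
    (by simpa using γ.target) (by simpa using γ.source)

/-- Concatenation of paths: `γ (2 t)` for `t ≤ 1 / 2`, and `ρ (2 t - 1)` for `1 / 2 ≤ t`. -/
noncomputable def trans (γ : LimPath x y) (ρ : LimPath y z) : LimPath x z :=
  ofTCont (fun t => if (t : ℝ) ≤ 1 / 2 then γ (dbl t) else ρ (dbl' t))
    (TCont.if_le (γ.tCont.comp (by fun_prop)) (ρ.tCont.comp (by fun_prop)) (by fun_prop)
      (by fun_prop) fun t ht => by rw [dbl_of_half ht, dbl'_of_half ht, γ.target, ρ.source])
    (by simp [γ.source])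
    (by norm_num [ρ.target])

/-- The image of a path under a continuous map. -/
def map {Y : Type v} [LimitSpace Y] (f : LimMap X Y) (γ : LimPath x y) : LimPath (f x) (f y) where
  toLimMap := f.comp γ.toLimMap
  source := congrArg f γ.source
  target := congrArg f γ.target

theorem refl_apply (x : X) (t : unitInterval) : (refl x) t = x := rfl

theorem symm_apply (γ : LimPath x y) (t : unitInterval) : γ.symm t = γ (unitInterval.symm t) := rfl

theorem trans_apply (γ : LimPath x y) (ρ : LimPath y z) (t : unitInterval) :
    (γ.trans ρ) t = if (t : ℝ) ≤ 1 / 2 then γ (dbl t) else ρ (dbl' t) := rfl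

theorem map_apply {Y : Type v} [LimitSpace Y] (f : LimMap X Y) (γ : LimPath x y)
    (t : unitInterval) : (γ.map f) t = f (γ t) := rfl

theorem apply_congr (γ : LimPath x y) {s t : unitInterval} (h : (s : ℝ) = t) : γ s = γ t :=
  congrArg γ.toFun (Subtype.ext h)

theorem ext_fun {γ γ' : LimPath x y} (h : ∀ t, γ t = γ' t) : γ = γ' :=
  LimPath.ext (funext h)

theorem Homotopic.hcomp {γ γ' : LimPath x y} {ρ ρ' : LimPath y z} (h : Homotopic γ γ')
    (h' : Homotopic ρ ρ') : Homotopic (γ.trans ρ) (γ'.trans ρ') := by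
  obtain ⟨K, hK, a0, a1, a⟩ := homotopic_iff.1 h
  obtain ⟨L, hL, b0, b1, b⟩ := homotopic_iff.1 h'
  refine homotopic_iff.2 ⟨fun p => if (p.2 : ℝ) ≤ 1 / 2 then K (p.1, dbl p.2) else L (p.1, dbl' p.2),
    TCont.if_le (hK.comp (by fun_prop)) (hL.comp (by fun_prop)) (by fun_prop) (by fun_prop) ?_,
    ?_, ?_, ?_⟩
  · intro p hp
    rw [dbl_of_half hp, dbl'_of_half hp, (a _).2, (b _).1]
  · intro s
    simp only [a0, b0, trans_apply]
  · intro s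
    simp only [a1, b1, trans_apply]
  · intro t
    norm_num [a, b]

theorem Homotopic.symm₂ {γ γ' : LimPath x y} (h : Homotopic γ γ') :
    Homotopic γ.symm γ'.symm := by
  obtain ⟨K, hK, a0, a1, a⟩ := homotopic_iff.1 h
  exact homotopic_iff.2 ⟨fun p => K (p.1, unitInterval.symm p.2), hK.comp (by fun_prop),
    fun s => a0 _, fun s => a1 _, fun t => by simpa using (a t).symm⟩

theorem Homotopic.map {Y : Type v} [LimitSpace Y] (f : LimMap X Y) {γ γ' : LimPath x y}
    (h : Homotopic γ γ') : Homotopic (γ.map f) (γ'.map f) := by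
  obtain ⟨K, hK, a0, a1, a⟩ := homotopic_iff.1 h
  exact homotopic_iff.2 ⟨fun p => f (K p), TCont.map hK f, fun s => congrArg f (a0 s),
    fun s => congrArg f (a1 s), fun t => ⟨congrArg f (a t).1, congrArg f (a t).2⟩⟩

/-- A path is rel-homotopic to its reparametrizations. -/
theorem Homotopic.reparam (γ γ' : LimPath x y) {φ : unitInterval → ℝ} (hφ : Continuous φ)
    (hI : ∀ t, φ t ∈ unitInterval) (h0 : φ 0 = 0) (h1 : φ 1 = 1)
    (h : ∀ t, γ' t = γ ⟨φ t, hI t⟩) : Homotopic γ γ' := by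
  have key : ∀ p : unitInterval × unitInterval,
      (1 - (p.1 : ℝ)) * p.2 + p.1 * φ p.2 ∈ unitInterval := fun p =>
    convex_Icc (0 : ℝ) 1 p.2.2 (hI p.2) (by linarith [p.1.2.2]) p.1.2.1 (by ring)
  refine homotopic_iff.2 ⟨fun p => γ ⟨_, key p⟩,
    γ.tCont.comp (Continuous.subtype_mk (by fun_prop) _), fun s => ?_, fun s => ?_, fun t => ⟨?_, ?_⟩⟩
  · exact γ.apply_congr (by simp)
  · exact (γ.apply_congr (by simp)).trans (h s).symm
  · exact (γ.apply_congr (by simp [h0])).trans γ.source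
  · exact (γ.apply_congr (by simp [h1])).trans γ.target

theorem trans_refl (γ : LimPath x y) : Homotopic (γ.trans (refl y)) γ := by
  refine (Homotopic.reparam γ _ Path.Homotopy.continuous_transReflReparamAux
    Path.Homotopy.transReflReparamAux_mem_I Path.Homotopy.transReflReparamAux_zero
    Path.Homotopy.transReflReparamAux_one fun t => ?_).symm
  rw [trans_apply]
  split_ifs with ht
  · exact γ.apply_congr (by simp only [coe_dbl ht, Path.Homotopy.transReflReparamAux, if_pos ht])
  · exact γ.target.symm.trans
      (γ.apply_congr (by simp only [Path.Homotopy.transReflReparamAux, if_neg ht, Set.Icc.coe_one]))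

theorem symm_symm (γ : LimPath x y) : γ.symm.symm = γ :=
  ext_fun fun t => by simp only [symm_apply, unitInterval.symm_symm]

theorem trans_symm' (γ : LimPath x y) (ρ : LimPath y z) :
    (γ.trans ρ).symm = ρ.symm.trans γ.symm := by
  refine ext_fun fun t => ?_
  have e1 := coe_dbl (t := t)
  have e2 := coe_dbl' (t := t)
  have e3 := coe_dbl (t := unitInterval.symm t)
  have e4 := coe_dbl' (t := unitInterval.symm t)
  simp only [unitInterval.coe_symm_eq] at e3 e4
  rw [symm_apply, trans_apply, trans_apply, symm_apply, symm_apply, unitInterval.coe_symm_eq]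
  rcases lt_trichotomy (t : ℝ) (1 / 2) with ht | ht | ht
  · rw [if_neg (by linarith), if_pos ht.le]
    congr 1
    ext
    rw [unitInterval.coe_symm_eq, e1 ht.le, e4 (by linarith)]
    ring
  · rw [if_pos (by linarith), if_pos ht.le, dbl_of_half ht,
      dbl_of_half (t := unitInterval.symm t) (by rw [unitInterval.coe_symm_eq]; linarith),
      unitInterval.symm_one, γ.target, ρ.source]
  · rw [if_pos (by linarith), if_neg (by linarith)]
    congr 1
    ext
    rw [unitInterval.coe_symm_eq, e2 ht.le, e3 (by linarith)]
    ring

theorem refl_trans (γ : LimPath x y) : Homotopic ((refl x).trans γ) γ := by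
  have h := (trans_refl γ.symm).symm₂
  rw [trans_symm', symm_symm] at h
  exact h

theorem trans_symm (γ : LimPath x y) : Homotopic (γ.trans γ.symm) (refl x) := by
  refine (homotopic_iff.2 ⟨fun p => γ ⟨Path.Homotopy.reflTransSymmAux p,
    Path.Homotopy.reflTransSymmAux_mem_I p⟩,
    γ.tCont.comp (Continuous.subtype_mk (by fun_prop) _), fun s => ?_, fun s => ?_,
    fun t => ⟨?_, ?_⟩⟩ : Homotopic (refl x) (γ.trans γ.symm)).symm
  · exact (γ.apply_congr (by simp [Path.Homotopy.reflTransSymmAux])).trans γ.source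
  · rw [trans_apply, symm_apply]
    split_ifs with hs
    · refine γ.apply_congr ?_
      simp only [Path.Homotopy.reflTransSymmAux, if_pos hs, coe_dbl hs, Set.Icc.coe_one, one_mul]
    · refine γ.apply_congr ?_
      rw [unitInterval.coe_symm_eq, coe_dbl' (not_le.1 hs).le]
      simp only [Path.Homotopy.reflTransSymmAux, if_neg hs, Set.Icc.coe_one]
      ring
  · exact (γ.apply_congr (by simp [Path.Homotopy.reflTransSymmAux])).trans γ.source
  · exact (γ.apply_congr (by norm_num [Path.Homotopy.reflTransSymmAux])).trans γ.source

theorem symm_trans (γ : LimPath x y) : Homotopic (γ.symm.trans γ) (refl y) := by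
  have h := trans_symm γ.symm
  rwa [symm_symm] at h

theorem trans_assoc {w : X} (γ : LimPath w x) (ρ : LimPath x y) (σ : LimPath y z) :
    Homotopic ((γ.trans ρ).trans σ) (γ.trans (ρ.trans σ)) := by
  refine (Homotopic.reparam _ _ Path.Homotopy.continuous_transAssocReparamAux
    Path.Homotopy.transAssocReparamAux_mem_I Path.Homotopy.transAssocReparamAux_zero
    Path.Homotopy.transAssocReparamAux_one fun t => ?_).symm
  generalize hu : (⟨Path.Homotopy.transAssocReparamAux t, _⟩ : unitInterval) = u
  have hu' : (u : ℝ) = Path.Homotopy.transAssocReparamAux t := by rw [← hu]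
  unfold Path.Homotopy.transAssocReparamAux at hu'
  simp only [trans_apply]
  by_cases h2 : (t : ℝ) ≤ 1 / 2
  · have e := coe_dbl h2
    by_cases h4 : (t : ℝ) ≤ 1 / 4
    · rw [if_pos h4] at hu'
      rw [if_pos h2, if_pos (by linarith), if_pos (by linarith)]
      exact γ.apply_congr (by rw [coe_dbl (by linarith), coe_dbl (by linarith), coe_dbl (by linarith), hu'])
    · rw [if_neg h4, if_pos h2] at hu'
      have e2 := coe_dbl' (t := u) (by linarith)
      rw [if_pos h2, if_neg (by linarith), if_neg (by linarith), if_pos (by linarith)]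
      exact ρ.apply_congr (by rw [coe_dbl' (by linarith), coe_dbl (by linarith), coe_dbl (by linarith), e2, hu']; ring)
  · rw [if_neg (by linarith), if_neg h2] at hu'
    have e2 := coe_dbl' (t := u) (by linarith)
    rw [if_neg h2, if_neg (by linarith), if_neg (by linarith)]
    exact σ.apply_congr (by rw [coe_dbl' (by linarith), coe_dbl' (by linarith), e2, hu']; ring)

theorem map_trans {Y : Type v} [LimitSpace Y] (f : LimMap X Y) (γ : LimPath x y)
    (ρ : LimPath y z) : (γ.trans ρ).map f = (γ.map f).trans (ρ.map f) :=
  ext_fun fun t => by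
    simp only [map_apply, trans_apply]
    split_ifs <;> rfl

end LimPath

/-! ### The fundamental groupoid -/

/-- The objects of the fundamental groupoid of `X` are the points of `X`. -/
@[ext] structure LimFundamentalGroupoid (X : Type u) where
  as : X

/-- The fundamental groupoid of a limit space: arrows are rel-homotopy classes of paths, and the
composite of the class of `γ : x ⟶ y` with that of `ρ : y ⟶ z` is the class of the
concatenation. -/
noncomputable instance (X : Type u) [LimitSpace X] : Groupoid (LimFundamentalGroupoid X) where
  Hom x y := Quotient (LimPath.setoid x.as y.as)
  id x := Quotient.mk _ (LimPath.refl x.as)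
  comp {x y z} := Quotient.map₂ LimPath.trans fun _ _ h _ _ h' => LimPath.Homotopic.hcomp h h'
  id_comp := by rintro _ _ ⟨γ⟩; exact Quotient.sound (LimPath.refl_trans γ)
  comp_id := by rintro _ _ ⟨γ⟩; exact Quotient.sound (LimPath.trans_refl γ)
  assoc := by rintro _ _ _ _ ⟨γ⟩ ⟨ρ⟩ ⟨σ⟩; exact Quotient.sound (LimPath.trans_assoc γ ρ σ)
  inv {x y} := Quotient.map LimPath.symm fun _ _ h => LimPath.Homotopic.symm₂ h
  inv_comp := by rintro _ _ ⟨γ⟩; exact Quotient.sound (LimPath.symm_trans γ)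
  comp_inv := by rintro _ _ ⟨γ⟩; exact Quotient.sound (LimPath.trans_symm γ)

/-- The functor induced by a continuous map `f`, sending the class of `γ` to that of `f ∘ γ`. -/
noncomputable def LimFundamentalGroupoid.map {X : Type u} {Y : Type v} [LimitSpace X]
    [LimitSpace Y] (f : LimMap X Y) : LimFundamentalGroupoid X ⥤ LimFundamentalGroupoid Y where
  obj x := ⟨f x.as⟩
  map := Quotient.map (LimPath.map f) fun _ _ h => LimPath.Homotopic.map f h
  map_id _ := rfl
  map_comp := by
    rintro _ _ _ ⟨γ⟩ ⟨ρ⟩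
    exact congrArg (Quotient.mk _) (LimPath.map_trans f γ ρ)

/-- The category of limit spaces and continuous maps. -/
structure LimCat : Type (u + 1) where
  carrier : Type u
  [str : LimitSpace carrier]

attribute [instance] LimCat.str

instance : Category LimCat.{u} where
  Hom X Y := LimMap X.carrier Y.carrier
  id X := LimMap.id X.carrier
  comp f g := g.comp f

/-- The fundamental groupoid functor from limit spaces to groupoids. -/
noncomputable def limFundamentalGroupoidFunctor : LimCat.{u} ⥤ Grpd.{u, u} where
  obj X := Grpd.of (LimFundamentalGroupoid X.carrier)
  map f := LimFundamentalGroupoid.map f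
  map_id X := by
    refine CategoryTheory.Functor.ext (fun _ => rfl) ?_
    rintro _ _ ⟨γ⟩
    exact (Category.id_comp _).symm.trans (congrArg _ (Category.comp_id _).symm)
  map_comp f g := by
    refine CategoryTheory.Functor.ext (fun _ => rfl) ?_
    rintro _ _ ⟨γ⟩
    exact (Category.id_comp _).symm.trans (congrArg _ (Category.comp_id _).symm)

/-- A family `𝒪` of subsets of `X`, viewed as a category with inclusions as morphisms, gives a
diagram of subspaces of `X`. -/
def subspaceDiagram {X : Type u} [LimitSpace X] (𝒪 : Set (Set X)) : 𝒪 ⥤ LimCat.{u} where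
  obj U := ⟨(U : Set X)⟩
  map i := LimMap.inclusion (leOfHom i)

/-- The cocone with point `X` formed by the inclusions `U ⊆ X` for `U ∈ 𝒪`. -/
def subspaceCocone {X : Type u} [LimitSpace X] (𝒪 : Set (Set X)) :
    Limits.Cocone (subspaceDiagram 𝒪) where
  pt := ⟨X⟩
  ι := { app := fun U => LimMap.subtypeVal (U : Set X) }

/-! A cocone over the diagram is a compatible family of functors `F U`, and it has to factor
uniquely through Π(X). The object over a point `x` is forced: take the value of any `F U` with `x ∈
U`. Closure under intersections makes this independent of `U`, and likewise the arrow assigned to a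
path lying inside a member of `𝒪`.

An arbitrary path is cut by repeated bisection. A convergence system applied to the images of
neighbourhood filters shows that the interiors of the preimages of its members cover a compact
domain, so a Lebesgue number exists (`exists_isLebesgueNumber`) and sufficiently fine dyadic pieces
each lie in one member. The value of the path is the composite of the values of its pieces. No
common refinements of subdivisions are needed: concatenation always cuts at the midpoint, so a
decomposition is a binary tree, and two trees for one path either cut it identically or one of them
stops at a path inside a single member (`Evaluates.unique`).

Homotopy invariance is phrased as commutativity of the boundary of a square, a property that follows
for a square from its four quarters. Small squares commute because the two boundary routes are
homotopic inside one member (`homotopic_of_square`), and all squares follow by bisection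
(`evaluates_square`). Uniqueness of the factorization is the same induction: a functor is determined
by its values on small paths. -/

namespace unitInterval

/-- The reparametrization `t ↦ t / 2`. -/
noncomputable def lowerHalf (t : unitInterval) : unitInterval :=
  ⟨t / 2, by have := t.2.1; positivity, by have := t.2.2; linarith⟩

/-- The reparametrization `t ↦ (1 + t) / 2`. -/
noncomputable def upperHalf (t : unitInterval) : unitInterval :=
  ⟨(1 + t) / 2, by have := t.2.1; positivity, by have := t.2.2; linarith⟩

@[simp] theorem coe_lowerHalf (t : unitInterval) : (lowerHalf t : ℝ) = t / 2 := rfl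

@[simp] theorem coe_upperHalf (t : unitInterval) : (upperHalf t : ℝ) = (1 + t) / 2 := rfl

@[fun_prop] theorem continuous_lowerHalf : Continuous lowerHalf :=
  Continuous.subtype_mk (by fun_prop) _

@[fun_prop] theorem continuous_upperHalf : Continuous upperHalf :=
  Continuous.subtype_mk (by fun_prop) _

@[simp] theorem lowerHalf_zero : lowerHalf 0 = 0 := by ext; simp

@[simp] theorem upperHalf_one : upperHalf 1 = 1 := by ext; norm_num

theorem upperHalf_zero : upperHalf 0 = lowerHalf 1 := by ext; simp

theorem dist_lowerHalf (s t : unitInterval) :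
    dist (lowerHalf s) (lowerHalf t) = dist s t / 2 := by
  simp only [Subtype.dist_eq, Real.dist_eq, coe_lowerHalf]
  rw [← sub_div, abs_div, abs_two]

theorem dist_upperHalf (s t : unitInterval) :
    dist (upperHalf s) (upperHalf t) = dist s t / 2 := by
  simp only [Subtype.dist_eq, Real.dist_eq, coe_upperHalf]
  rw [← sub_div, abs_div, abs_two, add_sub_add_left_eq_sub]

end unitInterval

open unitInterval

/-! ### Halves of paths, corestriction, and boundaries of squares -/

namespace LimPath

variable {X : Type u} [LimitSpace X] {x y z : X}

theorem trans_lowerHalf (γ : LimPath x y) (ρ : LimPath y z) (t : unitInterval) :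
    (γ.trans ρ) (lowerHalf t) = γ t := by
  have h : (lowerHalf t : ℝ) ≤ 1 / 2 := by have := t.2.2; simp only [coe_lowerHalf]; linarith
  rw [trans_apply, if_pos h]
  exact γ.apply_congr (by rw [coe_dbl h, coe_lowerHalf]; ring)

theorem trans_upperHalf (γ : LimPath x y) (ρ : LimPath y z) (t : unitInterval) :
    (γ.trans ρ) (upperHalf t) = ρ t := by
  have h : 1 / 2 ≤ (upperHalf t : ℝ) := by have := t.2.1; simp only [coe_upperHalf]; linarith
  rw [trans_apply]
  split_ifs with h'
  · have e := le_antisymm h' h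
    have ht : t = 0 := Subtype.ext (by
      simp only [coe_upperHalf] at e
      simp only [Set.Icc.coe_zero]
      linarith)
    rw [dbl_of_half e, γ.target, ht, ρ.source]
  · exact ρ.apply_congr (by rw [coe_dbl' h, coe_upperHalf]; ring)

/-- Both intermediate points are the value at 1/2. This comes before `trans_inj`, which can compare
the halves only once their types agree. -/
theorem eq_of_trans_eq {z' : X} {γ : LimPath x z} {ρ : LimPath z y} {γ' : LimPath x z'}
    {ρ' : LimPath z' y} (h : γ.trans ρ = γ'.trans ρ') : z = z' := by
  rw [← γ.target, ← γ'.target, ← trans_lowerHalf γ ρ, h, trans_lowerHalf]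

theorem trans_inj {γ γ' : LimPath x z} {ρ ρ' : LimPath z y} (h : γ.trans ρ = γ'.trans ρ') :
    γ = γ' ∧ ρ = ρ' :=
  ⟨ext_fun fun t => by rw [← trans_lowerHalf γ ρ, h, trans_lowerHalf],
    ext_fun fun t => by rw [← trans_upperHalf γ ρ, h, trans_upperHalf]⟩

/-- The first half of a path. -/
noncomputable def fst (γ : LimPath x y) : LimPath x (γ (lowerHalf 1)) :=
  ofTCont (fun t => γ (lowerHalf t)) (γ.tCont.comp (by fun_prop)) (by simp [γ.source]) rfl

/-- The second half of a path. -/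
noncomputable def snd (γ : LimPath x y) : LimPath (γ (lowerHalf 1)) y :=
  ofTCont (fun t => γ (upperHalf t)) (γ.tCont.comp (by fun_prop)) (by rw [upperHalf_zero])
    (by simp [γ.target])

theorem fst_apply (γ : LimPath x y) (t : unitInterval) : γ.fst t = γ (lowerHalf t) := rfl

theorem snd_apply (γ : LimPath x y) (t : unitInterval) : γ.snd t = γ (upperHalf t) := rfl

theorem fst_trans_snd (γ : LimPath x y) : γ.fst.trans γ.snd = γ := by
  refine ext_fun fun t => ?_
  rw [trans_apply]
  split_ifs with h
  · exact γ.apply_congr (by rw [coe_lowerHalf, coe_dbl h]; ring)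
  · exact γ.apply_congr (by rw [coe_upperHalf, coe_dbl' (not_le.1 h).le]; ring)

/-- A path that stays in a subspace, as a path in that subspace. -/
def codRestrict (γ : LimPath x y) (U : Set X) (h : ∀ t, γ t ∈ U) :
    LimPath (X := U) ⟨x, by simpa only [γ.source] using h 0⟩
      ⟨y, by simpa only [γ.target] using h 1⟩ where
  toFun t := ⟨γ t, h t⟩
  conv_map hF := by
    change Converges (Filter.map Subtype.val (Filter.map _ _)) _
    rw [Filter.map_map]
    exact γ.conv_map hF
  source := Subtype.ext γ.source
  target := Subtype.ext γ.target

theorem codRestrict_apply (γ : LimPath x y) (U : Set X) (h : ∀ t, γ t ∈ U) (t : unitInterval) :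
    (γ.codRestrict U h) t = ⟨γ t, h t⟩ := rfl

theorem codRestrict_trans (γ : LimPath x y) (ρ : LimPath y z) (U : Set X)
    (h : ∀ t, (γ.trans ρ) t ∈ U) (hγ : ∀ t, γ t ∈ U) (hρ : ∀ t, ρ t ∈ U) :
    (γ.trans ρ).codRestrict U h = (γ.codRestrict U hγ).trans (ρ.codRestrict U hρ) :=
  ext_fun fun t => by
    ext
    simp only [codRestrict_apply, trans_apply]
    split_ifs <;> rfl

/-- The two paths along the boundary of a square are rel-homotopic. -/
theorem homotopic_of_square {w : X} {K : unitInterval × unitInterval → X} (hK : TCont K)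
    (b : LimPath x y) (r : LimPath y w) (l : LimPath x z) (t : LimPath z w)
    (hb : ∀ s, b s = K (s, 0)) (hr : ∀ s, r s = K (1, s)) (hl : ∀ s, l s = K (0, s))
    (ht : ∀ s, t s = K (s, 1)) : Homotopic (b.trans r) (l.trans t) := by
  have key : ∀ p : unitInterval × unitInterval, ∀ a c : unitInterval,
      (1 - (p.1 : ℝ)) * a + p.1 * c ∈ unitInterval := fun p a c =>
    convex_Icc (0 : ℝ) 1 a.2 c.2 (by linarith [p.1.2.2]) p.1.2.1 (by ring)
  have lo : ∀ s : unitInterval, (s : ℝ) ≤ 1 / 2 → dbl' s = 0 := fun s hs =>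
    Set.projIcc_of_le_left _ (by linarith)
  -- `dbl` and `dbl'` are truncated to the interval, so `(dbl s, dbl' s)` runs along the bottom and
  -- then the right edge without a case split, and `(dbl' s, dbl s)` along the left and then the
  -- top.
  have hi : ∀ s : unitInterval, ¬ (s : ℝ) ≤ 1 / 2 → dbl s = 1 := fun s hs =>
    Set.projIcc_of_right_le _ (by linarith)
  have z0 : dbl' 0 = 0 := lo 0 (by simp)
  have z1 : dbl 1 = 1 := hi 1 (by norm_num)
  -- Straight-line homotopy in the convex square between these two boundary routes, followed by `K`;
  -- both routes start at (0, 0) and end at (1, 1).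
  refine homotopic_iff.2 ⟨fun p => K (⟨_, key p (dbl p.2) (dbl' p.2)⟩,
    ⟨_, key p (dbl' p.2) (dbl p.2)⟩), hK.comp ?_, fun s => ?_, fun s => ?_, fun q => ⟨?_, ?_⟩⟩
  · exact (Continuous.subtype_mk (by fun_prop) _).prodMk (Continuous.subtype_mk (by fun_prop) _)
  · trans K (dbl s, dbl' s)
    · refine congrArg K (Prod.ext (Subtype.ext ?_) (Subtype.ext ?_)) <;> simp
    · rw [trans_apply]
      split_ifs with h
      · rw [hb, lo s h]
      · rw [hr, hi s h]
  · trans K (dbl' s, dbl s)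
    · refine congrArg K (Prod.ext (Subtype.ext ?_) (Subtype.ext ?_)) <;> simp
    · rw [trans_apply]
      split_ifs with h
      · rw [hl, lo s h]
      · rw [ht, hi s h]
  · rw [← b.source, hb]
    refine congrArg K (Prod.ext (Subtype.ext ?_) (Subtype.ext ?_)) <;> simp [z0]
  · rw [← r.target, hr]
    refine congrArg K (Prod.ext (Subtype.ext ?_) (Subtype.ext ?_)) <;> simp [z1]

end LimPath

/-! ### Bisection -/

/-- `ε` is a Lebesgue number for the cover of `Z` by the preimages of the members of `𝒪`. -/
def IsLebesgueNumber {Z X : Type*} [PseudoMetricSpace Z] (𝒪 : Set (Set X)) (f : Z → X)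
    (ε : ℝ) : Prop :=
  ∀ p, ∃ U ∈ 𝒪, ∀ q, dist q p ≤ ε → f q ∈ U

theorem IsLebesgueNumber.comp {Z W X : Type*} [PseudoMetricSpace Z] [PseudoMetricSpace W]
    {𝒪 : Set (Set X)} {f : Z → X} {ε : ℝ} (h : IsLebesgueNumber 𝒪 f (ε / 2)) {g : W → Z}
    (hg : ∀ p q, dist (g p) (g q) ≤ dist p q / 2) : IsLebesgueNumber 𝒪 (fun w => f (g w)) ε :=
  fun p => by
    obtain ⟨U, hU, H⟩ := h (g p)
    exact ⟨U, hU, fun q hq => H _ ((hg q p).trans (by linarith))⟩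

/-- The image of the neighbourhood filter of each point converges, so some member of `𝒪` has a
preimage that is a neighbourhood. Members need not be open, hence the passage to interiors before
applying the Lebesgue number lemma. A power of 1/2 is chosen so that its exponent counts bisections.
-/
theorem LimitSpace.IsConvergenceSystem.exists_isLebesgueNumber {Z : Type*} {X : Type u}
    [PseudoMetricSpace Z] [CompactSpace Z] [LimitSpace X] {𝒪 : Set (Set X)}
    (h𝒪 : IsConvergenceSystem 𝒪) {f : Z → X} (hf : TCont f) :
    ∃ n : ℕ, IsLebesgueNumber 𝒪 f ((1 / 2) ^ n) := by
  obtain ⟨δ, hδ, H⟩ := lebesgue_number_lemma_of_metric (s := (Set.univ : Set Z))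
    (c := fun U : 𝒪 => interior (f ⁻¹' U)) isCompact_univ (fun _ => isOpen_interior)
    (fun z _ => by
      obtain ⟨U, hU, h⟩ := h𝒪 (f z) _ (hf z)
      exact Set.mem_iUnion.2 ⟨⟨U, hU⟩, mem_interior_iff_mem_nhds.2 h⟩)
  obtain ⟨n, hn⟩ := exists_pow_lt_of_lt_one hδ (by norm_num : (1 / 2 : ℝ) < 1)
  refine ⟨n, fun p => ?_⟩
  obtain ⟨U, h⟩ := H p trivial
  exact ⟨U, U.2, fun q hq => interior_subset (s := f ⁻¹' U)
    (h (Metric.mem_ball.2 (hq.trans_lt hn)))⟩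

theorem unitInterval.dist_le_one (s t : unitInterval) : dist s t ≤ 1 := by
  rw [Subtype.dist_eq]
  simpa using Real.dist_le_of_mem_Icc s.2 t.2

/-- To prove a property of all paths, it suffices to prove it for paths inside members of a
convergence system and for concatenations. -/
theorem LimPath.bisection_induction {X : Type u} [LimitSpace X] {𝒪 : Set (Set X)}
    (h𝒪 : IsConvergenceSystem 𝒪) {P : ∀ {x y : X}, LimPath x y → Prop}
    (small : ∀ {x y : X} (γ : LimPath x y), ∀ U ∈ 𝒪, (∀ t, γ t ∈ U) → P γ)
    (trans : ∀ {x y z : X} (γ : LimPath x y) (ρ : LimPath y z), P γ → P ρ → P (γ.trans ρ))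
    {x y : X} (γ : LimPath x y) : P γ := by
  obtain ⟨n, hn⟩ := h𝒪.exists_isLebesgueNumber γ.tCont
  induction n generalizing x y with
  | zero =>
    -- The Lebesgue number is now 1, which bounds every distance in the interval, so one member
    -- contains the whole path.
    obtain ⟨U, hU, H⟩ := hn 0
    exact small γ U hU fun t => H t (by simpa using dist_le_one t 0)
  | succ n ih =>
    rw [pow_succ, mul_one_div] at hn
    rw [← γ.fst_trans_snd]
    exact trans _ _ (ih _ (hn.comp fun p q => (dist_lowerHalf p q).le))
      (ih _ (hn.comp fun p q => (dist_upperHalf p q).le))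

/-- To prove a property of all maps from the unit square, it suffices to prove it for maps into
members of a convergence system and to deduce it for a square from its four quarters. -/
theorem TCont.square_induction {X : Type u} [LimitSpace X] {𝒪 : Set (Set X)}
    (h𝒪 : IsConvergenceSystem 𝒪) {P : (unitInterval × unitInterval → X) → Prop}
    (small : ∀ K, TCont K → ∀ U ∈ 𝒪, (∀ p, K p ∈ U) → P K)
    (quarters : ∀ K, TCont K → P (fun p => K (lowerHalf p.1, lowerHalf p.2)) →
      P (fun p => K (lowerHalf p.1, upperHalf p.2)) →
      P (fun p => K (upperHalf p.1, lowerHalf p.2)) →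
      P (fun p => K (upperHalf p.1, upperHalf p.2)) → P K)
    {K : unitInterval × unitInterval → X} (hK : TCont K) : P K := by
  obtain ⟨n, hn⟩ := h𝒪.exists_isLebesgueNumber hK
  induction n generalizing K with
  | zero =>
    obtain ⟨U, hU, H⟩ := hn 0
    exact small K hK U hU fun t => H t
      (by simpa [Prod.dist_eq] using ⟨dist_le_one t.1 0, dist_le_one t.2 0⟩)
  | succ n ih =>
    rw [pow_succ, mul_one_div] at hn
    have key : ∀ {a b s t : ℝ}, a = s / 2 → b = t / 2 → max a b ≤ max s t / 2 := by
      rintro a b s t rfl rfl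
      exact (max_div_div_right zero_le_two s t).le
    refine quarters K hK (ih (hK.comp (by fun_prop)) (hn.comp fun p q => ?_))
      (ih (hK.comp (by fun_prop)) (hn.comp fun p q => ?_))
      (ih (hK.comp (by fun_prop)) (hn.comp fun p q => ?_))
      (ih (hK.comp (by fun_prop)) (hn.comp fun p q => ?_)) <;>
    · simp only [Prod.dist_eq]
      apply key <;> simp only [dist_lowerHalf, dist_upperHalf]

/-! ### Transport along paths from local data -/

/-- Arrows of `G` assigned to the paths inside the members of `𝒪`, functorially and compatibly with
boundaries of squares. -/
structure LocalTransport {X : Type u} [LimitSpace X] (𝒪 : Set (Set X)) (G : Type v)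
    [Category.{w} G] where
  obj : X → G
  map : ∀ U ∈ 𝒪, ∀ {x y : X} (γ : LimPath x y), (∀ t, γ t ∈ U) → (obj x ⟶ obj y)
  map_congr : ∀ U (hU : U ∈ 𝒪) V (hV : V ∈ 𝒪) {x y : X} (γ : LimPath x y) (h : ∀ t, γ t ∈ U)
    (h' : ∀ t, γ t ∈ V), map U hU γ h = map V hV γ h'
  map_refl : ∀ U (hU : U ∈ 𝒪) (x : X) (h : ∀ t, (LimPath.refl x) t ∈ U),
    map U hU (LimPath.refl x) h = 𝟙 (obj x)
  map_trans : ∀ U (hU : U ∈ 𝒪) {x y z : X} (γ : LimPath x y) (ρ : LimPath y z)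
    (h : ∀ t, (γ.trans ρ) t ∈ U) (hγ : ∀ t, γ t ∈ U) (hρ : ∀ t, ρ t ∈ U),
    map U hU (γ.trans ρ) h = map U hU γ hγ ≫ map U hU ρ hρ
  map_square : ∀ U (hU : U ∈ 𝒪) {K : unitInterval × unitInterval → X}, TCont K →
    (∀ p, K p ∈ U) → ∀ {x y z w : X} (b : LimPath x y) (r : LimPath y w) (l : LimPath x z)
    (t : LimPath z w), (∀ s, b s = K (s, 0)) → (∀ s, r s = K (1, s)) → (∀ s, l s = K (0, s)) →
    (∀ s, t s = K (s, 1)) → ∀ (hb : ∀ s, b s ∈ U) (hr : ∀ s, r s ∈ U) (hl : ∀ s, l s ∈ U)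
    (ht : ∀ s, t s ∈ U), map U hU b hb ≫ map U hU r hr = map U hU l hl ≫ map U hU t ht

namespace LocalTransport

variable {X : Type u} [LimitSpace X] {𝒪 : Set (Set X)} {G : Type v} [Category.{w} G]
  (T : LocalTransport 𝒪 G)

/-- `T.Evaluates γ g`: the arrow `g` is a composite of values of `T` on pieces of `γ`. -/
inductive Evaluates : ∀ {x y : X}, LimPath x y → (T.obj x ⟶ T.obj y) → Prop
  | small {x y : X} (γ : LimPath x y) (U : Set X) (hU : U ∈ 𝒪) (h : ∀ t, γ t ∈ U) :
    Evaluates γ (T.map U hU γ h)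
  | trans {x y z : X} {γ : LimPath x y} {ρ : LimPath y z} {g : T.obj x ⟶ T.obj y}
    {k : T.obj y ⟶ T.obj z} : Evaluates γ g → Evaluates ρ k → Evaluates (γ.trans ρ) (g ≫ k)

variable {T}

/-- Subdividing a path inside `U` keeps the pieces inside `U`; `map_congr` moves each piece's value
to `U` and `map_trans` reassembles them. -/
theorem Evaluates.eq_map {x y : X} {γ : LimPath x y} {g : T.obj x ⟶ T.obj y}
    (hg : T.Evaluates γ g) (U : Set X) (hU : U ∈ 𝒪) (h : ∀ t, γ t ∈ U) : g = T.map U hU γ h := by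
  induction hg with
  | small γ V hV h' => exact T.map_congr V hV U hU γ h' h
  | @trans x y z γ ρ g k _ _ ihg ihk =>
    have hγ : ∀ t, γ t ∈ U := fun t => by rw [← LimPath.trans_lowerHalf γ ρ]; exact h _
    have hρ : ∀ t, ρ t ∈ U := fun t => by rw [← LimPath.trans_upperHalf γ ρ]; exact h _
    rw [T.map_trans U hU γ ρ h hγ hρ, ihg hγ, ihk hρ]

theorem Evaluates.unique {x y : X} {γ : LimPath x y} {g g' : T.obj x ⟶ T.obj y}
    (hg : T.Evaluates γ g) (hg' : T.Evaluates γ g') : g = g' := by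
  induction hg with
  | small γ U hU h => exact (hg'.eq_map U hU h).symm
  | @trans x y z γ ρ g k hg hk ihg ihk =>
    -- Case analysis on `hg'` needs a variable as path index; the equation `hθ` then identifies the
    -- two midpoint cuts.
    generalize hθ : γ.trans ρ = θ at hg'
    cases hg' with
    | small _ U hU h => subst hθ; exact (hg.trans hk).eq_map U hU h
    | trans h₁ h₂ =>
      obtain rfl := LimPath.eq_of_trans_eq hθ
      obtain ⟨rfl, rfl⟩ := LimPath.trans_inj hθ
      rw [ihg h₁, ihk h₂]

theorem exists_evaluates (h𝒪 : IsConvergenceSystem 𝒪) (T : LocalTransport 𝒪 G) {x y : X}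
    (γ : LimPath x y) : ∃ g, T.Evaluates γ g :=
  LimPath.bisection_induction h𝒪 (P := fun γ => ∃ g, T.Evaluates γ g)
    (fun γ U hU h => ⟨_, .small γ U hU h⟩) (fun _ _ ⟨_, h⟩ ⟨_, h'⟩ => ⟨_, h.trans h'⟩) γ

theorem evaluates_refl (h𝒪 : IsConvergenceSystem 𝒪) (T : LocalTransport 𝒪 G) (x : X) :
    T.Evaluates (LimPath.refl x) (𝟙 (T.obj x)) := by
  obtain ⟨U, hU, hx⟩ := h𝒪 x _ (centered x)
  rw [← T.map_refl U hU x fun _ => hx]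
  exact .small _ U hU _

theorem evaluates_square (h𝒪 : IsConvergenceSystem 𝒪) (T : LocalTransport 𝒪 G)
    {K : unitInterval × unitInterval → X} (hK : TCont K) {x y z w : X} {b : LimPath x y}
    {r : LimPath y w} {l : LimPath x z} {t : LimPath z w} (hb : ∀ s, b s = K (s, 0))
    (hr : ∀ s, r s = K (1, s)) (hl : ∀ s, l s = K (0, s)) (ht : ∀ s, t s = K (s, 1))
    {β : T.obj x ⟶ T.obj y} {ρ : T.obj y ⟶ T.obj w} {lam : T.obj x ⟶ T.obj z}
    {τ : T.obj z ⟶ T.obj w} (eb : T.Evaluates b β) (er : T.Evaluates r ρ)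
    (el : T.Evaluates l lam) (et : T.Evaluates t τ) : β ≫ ρ = lam ≫ τ := by
  -- Corners, edges and their values are all quantified inside the property, since they change on
  -- passing to a quarter.
  refine TCont.square_induction h𝒪 (P := fun K => ∀ {x y z w : X} {b : LimPath x y}
    {r : LimPath y w} {l : LimPath x z} {t : LimPath z w} (_ : ∀ s, b s = K (s, 0))
    (_ : ∀ s, r s = K (1, s)) (_ : ∀ s, l s = K (0, s)) (_ : ∀ s, t s = K (s, 1))
    {β : T.obj x ⟶ T.obj y} {ρ : T.obj y ⟶ T.obj w} {lam : T.obj x ⟶ T.obj z}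
    {τ : T.obj z ⟶ T.obj w} (_ : T.Evaluates b β) (_ : T.Evaluates r ρ)
    (_ : T.Evaluates l lam) (_ : T.Evaluates t τ), β ≫ ρ = lam ≫ τ) ?_ ?_ hK hb hr hl ht eb er el et
  · intro K hK U hU hKU x y z w b r l t hb hr hl ht β ρ lam τ eb er el et
    have ub : ∀ s, b s ∈ U := fun s => hb s ▸ hKU _
    have ur : ∀ s, r s ∈ U := fun s => hr s ▸ hKU _
    have ul : ∀ s, l s ∈ U := fun s => hl s ▸ hKU _
    have ut : ∀ s, t s ∈ U := fun s => ht s ▸ hKU _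
    rw [eb.eq_map U hU ub, er.eq_map U hU ur, el.eq_map U hU ul, et.eq_map U hU ut]
    exact T.map_square U hU hK hKU b r l t hb hr hl ht ub ur ul ut
  · intro K hK k₁ k₂ k₃ k₄ x y z w b r l t hb hr hl ht β ρ lam τ eb er el et
    -- By uniqueness, any value of an edge is the composite of values of its halves, however it was
    -- obtained.
    have split : ∀ {x y : X} (γ : LimPath x y) {g : T.obj x ⟶ T.obj y}, T.Evaluates γ g →
        ∃ g₁ g₂, T.Evaluates γ.fst g₁ ∧ T.Evaluates γ.snd g₂ ∧ g = g₁ ≫ g₂ := by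
      intro x y γ g hg
      obtain ⟨g₁, h₁⟩ := exists_evaluates h𝒪 T γ.fst
      obtain ⟨g₂, h₂⟩ := exists_evaluates h𝒪 T γ.snd
      exact ⟨g₁, g₂, h₁, h₂, hg.unique (by
        have h := h₁.trans h₂
        rwa [LimPath.fst_trans_snd] at h)⟩
    obtain ⟨β₁, β₂, eb₁, eb₂, rfl⟩ := split b eb
    obtain ⟨ρ₁, ρ₂, er₁, er₂, rfl⟩ := split r er
    obtain ⟨l₁, l₂, el₁, el₂, rfl⟩ := split l el
    obtain ⟨τ₁, τ₂, et₁, et₂, rfl⟩ := split t et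
    let v : LimPath (b (lowerHalf 1)) (t (lowerHalf 1)) := LimPath.ofTCont
      (fun s => K (lowerHalf 1, s)) (hK.comp (by fun_prop)) (hb _).symm (ht _).symm
    let h : LimPath (l (lowerHalf 1)) (r (lowerHalf 1)) := LimPath.ofTCont
      (fun s => K (s, lowerHalf 1)) (hK.comp (by fun_prop)) (hl _).symm (hr _).symm
    -- Both midlines pass through the centre by definition; naming it makes their halves composable
    -- without transport.
    let m : X := K (lowerHalf 1, lowerHalf 1)
    let v₁ : LimPath (b (lowerHalf 1)) m := v.fst
    let v₂ : LimPath m (t (lowerHalf 1)) := v.snd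
    let h₁ : LimPath (l (lowerHalf 1)) m := h.fst
    let h₂ : LimPath m (r (lowerHalf 1)) := h.snd
    obtain ⟨a₁, ea₁⟩ := exists_evaluates h𝒪 T v₁
    obtain ⟨a₂, ea₂⟩ := exists_evaluates h𝒪 T v₂
    obtain ⟨c₁, ec₁⟩ := exists_evaluates h𝒪 T h₁
    obtain ⟨c₂, ec₂⟩ := exists_evaluates h𝒪 T h₂
    have q₁ : β₁ ≫ a₁ = l₁ ≫ c₁ := by
      refine k₁ (fun s => ?_) (fun s => ?_) (fun s => ?_) (fun s => ?_) eb₁ ea₁ el₁ ec₁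
      · simp [LimPath.fst_apply, hb]
      · rfl
      · simp [LimPath.fst_apply, hl]
      · rfl
    have q₂ : c₁ ≫ a₂ = l₂ ≫ τ₁ := by
      refine k₂ (fun s => ?_) (fun s => ?_) (fun s => ?_) (fun s => ?_) ec₁ ea₂ el₂ et₁
      · dsimp only; rw [upperHalf_zero]; rfl
      · rfl
      · simp [LimPath.snd_apply, hl]
      · simp [LimPath.fst_apply, ht]
    have q₃ : β₂ ≫ ρ₁ = a₁ ≫ c₂ := by
      refine k₃ (fun s => ?_) (fun s => ?_) (fun s => ?_) (fun s => ?_) eb₂ er₁ ea₁ ec₂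
      · simp [LimPath.snd_apply, hb]
      · simp [LimPath.fst_apply, hr]
      · dsimp only; rw [upperHalf_zero]; rfl
      · rfl
    have q₄ : c₂ ≫ ρ₂ = a₂ ≫ τ₂ := by
      refine k₄ (fun s => ?_) (fun s => ?_) (fun s => ?_) (fun s => ?_) ec₂ er₂ ea₂ et₂
      · dsimp only; rw [upperHalf_zero]; rfl
      · simp [LimPath.snd_apply, hr]
      · dsimp only; rw [upperHalf_zero]; rfl
      · simp [LimPath.snd_apply, ht]
    -- The four quarters are pasted by pushing the route bottom-right across them to left-top.
    calc (β₁ ≫ β₂) ≫ ρ₁ ≫ ρ₂ = β₁ ≫ (β₂ ≫ ρ₁) ≫ ρ₂ := by simp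
      _ = (β₁ ≫ a₁) ≫ c₂ ≫ ρ₂ := by rw [q₃]; simp
      _ = l₁ ≫ (c₁ ≫ a₂) ≫ τ₂ := by rw [q₁, q₄]; simp
      _ = (l₁ ≫ l₂) ≫ τ₁ ≫ τ₂ := by rw [q₂]; simp

/-- A rel-homotopy is a square whose bottom and top edges are constant and whose left and right
edges are `γ` and `γ'`. -/
theorem Evaluates.eq_of_homotopic (h𝒪 : IsConvergenceSystem 𝒪) {x y : X} {γ γ' : LimPath x y}
    {g g' : T.obj x ⟶ T.obj y} (hg : T.Evaluates γ g) (hg' : T.Evaluates γ' g')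
    (h : γ.Homotopic γ') : g = g' := by
  obtain ⟨K, hK, h0, h1, h⟩ := LimPath.homotopic_iff.1 h
  simpa using (evaluates_square h𝒪 T hK (b := LimPath.refl x) (t := LimPath.refl y)
    (fun s => (h s).1.symm) (fun s => (h1 s).symm) (fun s => (h0 s).symm)
    (fun s => (h s).2.symm) (evaluates_refl h𝒪 T x) hg' hg (evaluates_refl h𝒪 T y)).symm

/-- The arrow assigned to a path. -/
noncomputable def eval (h𝒪 : IsConvergenceSystem 𝒪) (T : LocalTransport 𝒪 G) {x y : X}
    (γ : LimPath x y) : T.obj x ⟶ T.obj y := (exists_evaluates h𝒪 T γ).choose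

theorem evaluates_eval (h𝒪 : IsConvergenceSystem 𝒪) (T : LocalTransport 𝒪 G) {x y : X}
    (γ : LimPath x y) : T.Evaluates γ (T.eval h𝒪 γ) := (exists_evaluates h𝒪 T γ).choose_spec

/-- The functor on the fundamental groupoid determined by local data. -/
noncomputable def functor (h𝒪 : IsConvergenceSystem 𝒪) (T : LocalTransport 𝒪 G) :
    LimFundamentalGroupoid X ⥤ G where
  obj x := T.obj x.as
  map := Quotient.lift (fun γ => T.eval h𝒪 γ) fun _ _ h =>
    (evaluates_eval h𝒪 T _).eq_of_homotopic h𝒪 (evaluates_eval h𝒪 T _) h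
  map_id x := (evaluates_eval h𝒪 T _).unique (evaluates_refl h𝒪 T x.as)
  map_comp := by
    rintro _ _ _ ⟨γ⟩ ⟨ρ⟩
    exact (evaluates_eval h𝒪 T _).unique
      ((evaluates_eval h𝒪 T γ).trans (evaluates_eval h𝒪 T ρ))

/-- Both sides respect concatenation, so agreement on small paths propagates along any evaluation.
Objects agree only propositionally, hence the `eqToHom` conjugation, which cancels at the
intermediate points. -/
theorem eq_functor (h𝒪 : IsConvergenceSystem 𝒪) (T : LocalTransport 𝒪 G)
    (M : LimFundamentalGroupoid X ⥤ G) (ho : ∀ x, M.obj ⟨x⟩ = T.obj x)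
    (hM : ∀ U (hU : U ∈ 𝒪) {x y : X} (γ : LimPath x y) (h : ∀ t, γ t ∈ U),
      M.map (X := ⟨x⟩) (Y := ⟨y⟩) (Quotient.mk _ γ) =
        eqToHom (ho x) ≫ T.map U hU γ h ≫ eqToHom (ho y).symm) : M = T.functor h𝒪 := by
  have key : ∀ {x y : X} {γ : LimPath x y} {g : T.obj x ⟶ T.obj y}, T.Evaluates γ g →
      M.map (X := ⟨x⟩) (Y := ⟨y⟩) (Quotient.mk _ γ) =
        eqToHom (ho x) ≫ g ≫ eqToHom (ho y).symm := by
    intro x y γ g hg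
    induction hg with
    | small γ U hU h => exact hM U hU γ h
    | @trans x y z γ ρ _ _ _ _ ihg ihk =>
      refine (M.map_comp (X := ⟨x⟩) (Y := ⟨y⟩) (Z := ⟨z⟩) (Quotient.mk _ γ)
        (Quotient.mk _ ρ)).trans ?_
      rw [ihg, ihk]
      simp
  refine CategoryTheory.Functor.ext (fun x => ho x.as) ?_
  rintro x y ⟨γ⟩
  exact key (evaluates_eval h𝒪 T γ)

end LocalTransport

/-! ### Gluing compatible functors on the members of the system -/

namespace LimFundamentalGroupoid

variable {X : Type u} [LimitSpace X] {𝒪 : Set (Set X)} {G : Type v} [Category.{w} G]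

theorem exists_mem (h𝒪 : IsConvergenceSystem 𝒪) (x : X) : ∃ U : 𝒪, x ∈ U.1 := by
  obtain ⟨U, hU, hx⟩ := h𝒪 x _ (centered x)
  exact ⟨⟨U, hU⟩, hx⟩

variable (h𝒪 : IsConvergenceSystem 𝒪) (hinter : ∀ U ∈ 𝒪, ∀ V ∈ 𝒪, U ∩ V ∈ 𝒪)
  (F : ∀ U : 𝒪, LimFundamentalGroupoid U.1 ⥤ G)
  (hF : ∀ (U V : 𝒪) (h : U.1 ⊆ V.1), map (LimMap.inclusion h) ⋙ F V = F U)

/-- The value at a point of a compatible family of functors. -/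
noncomputable def glueObj (x : X) : G :=
  (F (exists_mem h𝒪 x).choose).obj ⟨⟨x, (exists_mem h𝒪 x).choose_spec⟩⟩

variable {F} in
-- `U` and the member chosen for `x` both contain their intersection, which belongs to `𝒪` and
-- contains `x`; compatibility along its two inclusions compares the values.
theorem obj_eq_glueObj (hinter : ∀ U ∈ 𝒪, ∀ V ∈ 𝒪, U ∩ V ∈ 𝒪)
    (hF : ∀ (U V : 𝒪) (h : U.1 ⊆ V.1), map (LimMap.inclusion h) ⋙ F V = F U)
    (U : 𝒪) {x : X} (hx : x ∈ U.1) : (F U).obj ⟨⟨x, hx⟩⟩ = glueObj h𝒪 F x := by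
  let V := (exists_mem h𝒪 x).choose
  have hV : x ∈ V.1 := (exists_mem h𝒪 x).choose_spec
  let W : 𝒪 := ⟨U.1 ∩ V.1, hinter _ U.2 _ V.2⟩
  let y : LimFundamentalGroupoid W.1 := ⟨⟨x, hx, hV⟩⟩
  exact (Functor.congr_obj (hF W U Set.inter_subset_left) y).trans
    (Functor.congr_obj (hF W V Set.inter_subset_right) y).symm

/-- The arrow that a compatible family of functors assigns to a path inside a member of `𝒪`. -/
noncomputable def glueMap (U : 𝒪) {x y : X} (γ : LimPath x y) (h : ∀ t, γ t ∈ U.1) :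
    glueObj h𝒪 F x ⟶ glueObj h𝒪 F y :=
  eqToHom (obj_eq_glueObj h𝒪 hinter hF U _).symm ≫
    (F U).map (X := ⟨_⟩) (Y := ⟨_⟩) (Quotient.mk _ (γ.codRestrict U.1 h)) ≫
      eqToHom (obj_eq_glueObj h𝒪 hinter hF U _)

theorem glueMap_mono (U V : 𝒪) (hUV : U.1 ⊆ V.1) {x y : X} (γ : LimPath x y)
    (h : ∀ t, γ t ∈ U.1) :
    glueMap h𝒪 hinter F hF U γ h = glueMap h𝒪 hinter F hF V γ (fun t => hUV (h t)) := by
  have e := Functor.congr_hom (hF U V hUV).symm (X := ⟨_⟩) (Y := ⟨_⟩)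
    (Quotient.mk _ (γ.codRestrict U.1 h))
  unfold glueMap
  rw [e]
  simp only [Category.assoc, eqToHom_trans, eqToHom_trans_assoc]
  rfl

/-- A compatible family of functors on the fundamental groupoids of the members of `𝒪`, as
transport along paths. -/
noncomputable def localTransport : LocalTransport 𝒪 G where
  obj := glueObj h𝒪 F
  map U hU _ _ γ h := glueMap h𝒪 hinter F hF ⟨U, hU⟩ γ h
  map_congr U hU V hV x y γ h h' := by
    -- The path lies in the intersection, from which `glueMap_mono` reaches both members.
    let W : 𝒪 := ⟨U ∩ V, hinter _ hU _ hV⟩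
    exact (glueMap_mono h𝒪 hinter F hF W ⟨U, hU⟩ Set.inter_subset_left γ
      fun t => ⟨h t, h' t⟩).symm.trans (glueMap_mono h𝒪 hinter F hF W ⟨V, hV⟩
        Set.inter_subset_right γ fun t => ⟨h t, h' t⟩)
  map_refl U hU x h := by
    have e := (F ⟨U, hU⟩).map_id ⟨⟨x, h 0⟩⟩
    unfold glueMap
    refine (congrArg (fun f => eqToHom _ ≫ f ≫ eqToHom _) e).trans ?_
    simp
  map_trans U hU x y z γ ρ h hγ hρ := by
    have e := (F ⟨U, hU⟩).map_comp (X := ⟨_⟩) (Y := ⟨_⟩) (Z := ⟨_⟩)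
      (Quotient.mk _ (γ.codRestrict U hγ)) (Quotient.mk _ (ρ.codRestrict U hρ))
    unfold glueMap
    rw [LimPath.codRestrict_trans γ ρ U h hγ hρ]
    refine (congrArg (fun f => eqToHom _ ≫ f ≫ eqToHom _) e).trans ?_
    simp
  map_square U hU K hK hKU x y z w b r l t hb hr hl ht ub ur ul ut := by
    -- The square is corestricted because `F U` only identifies paths that are homotopic within `U`.
    have hK' : TCont (fun p => (⟨K p, hKU p⟩ : U)) := fun p => by
      change Converges (Filter.map Subtype.val (Filter.map _ _)) _
      rw [Filter.map_map]
      exact hK p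
    have e := congrArg ((F ⟨U, hU⟩).map (X := ⟨_⟩) (Y := ⟨_⟩)) (Quotient.sound
      (s := LimPath.setoid _ _) (LimPath.homotopic_of_square hK' (b.codRestrict U ub)
      (r.codRestrict U ur) (l.codRestrict U ul) (t.codRestrict U ut)
      (fun s => Subtype.ext (hb s)) (fun s => Subtype.ext (hr s)) (fun s => Subtype.ext (hl s))
      (fun s => Subtype.ext (ht s))))
    have e' := ((F ⟨U, hU⟩).map_comp (X := ⟨_⟩) (Y := ⟨_⟩) (Z := ⟨_⟩)
      (Quotient.mk _ (b.codRestrict U ub)) (Quotient.mk _ (r.codRestrict U ur))).symm.trans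
      (e.trans ((F ⟨U, hU⟩).map_comp (X := ⟨_⟩) (Y := ⟨_⟩) (Z := ⟨_⟩)
      (Quotient.mk _ (l.codRestrict U ul)) (Quotient.mk _ (t.codRestrict U ut))))
    unfold glueMap
    have e'' := congrArg (fun f => eqToHom (obj_eq_glueObj h𝒪 hinter hF ⟨U, hU⟩ _).symm ≫ f ≫
      eqToHom (obj_eq_glueObj h𝒪 hinter hF ⟨U, hU⟩ _)) e'
    simpa using e''

/-- The functor glued from a compatible family. -/
noncomputable def glue : LimFundamentalGroupoid X ⥤ G :=
  (localTransport h𝒪 hinter F hF).functor h𝒪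

theorem map_subtypeVal_comp_glue (U : 𝒪) :
    map (LimMap.subtypeVal U.1) ⋙ glue h𝒪 hinter F hF = F U := by
  refine CategoryTheory.Functor.ext
    (fun x => (obj_eq_glueObj h𝒪 hinter hF U x.as.2).symm) ?_
  rintro x y ⟨γ⟩
  have h : ∀ t, (γ.map (LimMap.subtypeVal U.1)) t ∈ U.1 := fun t => (γ t).2
  -- A path from `U` is already small, so its glued value is `glueMap`, that is, `F U` conjugated by
  -- `eqToHom`, as equality of functors demands.
  exact (LocalTransport.evaluates_eval h𝒪 (localTransport h𝒪 hinter F hF)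
    (γ.map (LimMap.subtypeVal U.1))).eq_map U.1 U.2 h

theorem eq_glue (M : LimFundamentalGroupoid X ⥤ G)
    (hM : ∀ U : 𝒪, map (LimMap.subtypeVal U.1) ⋙ M = F U) : M = glue h𝒪 hinter F hF := by
  have ho : ∀ x : X, M.obj ⟨x⟩ = glueObj h𝒪 F x := fun x => by
    obtain ⟨U, hx⟩ := exists_mem h𝒪 x
    exact (Functor.congr_obj (hM U) ⟨⟨x, hx⟩⟩).trans
      (obj_eq_glueObj h𝒪 hinter hF U hx)
  refine LocalTransport.eq_functor h𝒪 (localTransport h𝒪 hinter F hF) M ho fun U hU _ _ γ h => ?_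
  refine (Functor.congr_hom (hM ⟨U, hU⟩) (X := ⟨_⟩) (Y := ⟨_⟩)
    (Quotient.mk _ (γ.codRestrict U h))).trans ?_
  change _ = eqToHom (ho _) ≫ glueMap h𝒪 hinter F hF ⟨U, hU⟩ γ h ≫ eqToHom (ho _).symm
  simp only [glueMap, Category.assoc, eqToHom_trans, eqToHom_trans_assoc]
  rfl

end LimFundamentalGroupoid

/-! ### The colimit property -/

theorem mainTheorem1 {X : Type u} [LimitSpace X] (𝒪 : Set (Set X))
    (h𝒪 : LimitSpace.IsConvergenceSystem 𝒪)
    (hinter : ∀ U ∈ 𝒪, ∀ V ∈ 𝒪, U ∩ V ∈ 𝒪) :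
    Nonempty (Limits.IsColimit
      (limFundamentalGroupoidFunctor.mapCocone (subspaceCocone 𝒪))) := by
  have hF (s : Limits.Cocone (subspaceDiagram 𝒪 ⋙ limFundamentalGroupoidFunctor)) (U V : 𝒪)
      (h : U.1 ⊆ V.1) : LimFundamentalGroupoid.map (LimMap.inclusion h) ⋙ s.ι.app V = s.ι.app U :=
    s.w (homOfLE h : U ⟶ V)
  exact ⟨{
    desc := fun s => LimFundamentalGroupoid.glue h𝒪 hinter (fun U => s.ι.app U) (hF s)
    fac := fun s U => LimFundamentalGroupoid.map_subtypeVal_comp_glue h𝒪 hinter _ (hF s) U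
    uniq := fun s m hm => LimFundamentalGroupoid.eq_glue h𝒪 hinter _ (hF s) m hm }⟩
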